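/- Let $k$ be a perfect field with algebraic closure $\overline{k}$, and let $p$ be a prime number with $p \neq \operatorname{char}(k)$. Let $\zeta_p \in \overline{k}$ be a primitive $p$-th root of unity, put $t = [k(\zeta_p):k]$, and let $\varphi$ be Euler's function. A $d$-dimensional algebraic torus over $k$ is an affine group scheme $T$ over $k$ with $T_{\overline{k}} \cong \mathbb{G}_{m,\overline{k}}^{\,d}$ as group schemes over $\overline{k}$, and $T(k)[p] = \{x \in T(k) : x^p = 1\}$. (1) For every $d \ge 0$ and every $d$-dimensional algebraic torus $T$ over $k$, the group $T(k)[p]$ is isomorphic to $(\mathbb{Z}/p)^r$ for some integer $r \ge 0$ (its rank, $r = \operatorname{rk} T(k)[p]$), and $$\operatorname{rk} T(k)[p] \le \frac{d}{\varphi(t)}.$$ (2) The bound is attained: for every $d \ge 0$ there is a $d$-dimensional algebraic torus $T$ over $k$ with $\operatorname{rk} T(k)[p] = \left\lfloor \frac{d}{\varphi(t)} \right\rfloor$; in particular $\operatorname{rk} T(k)[p] = \frac{d}{\varphi(t)}$ whenever $\varphi(t) \mid d$. -/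

import Mathlib

open scoped TensorProduct

/-- An algebraic torus of dimension `d` over the field `k`: an affine group scheme `T` over `k`,
given by its coordinate ring `k[T]` (a commutative Hopf algebra over `k`), that becomes isomorphic,
as a group scheme over the algebraic closure `K` of `k`, to the split torus `𝔾ₘ ^ d`. The coordinate
ring of `𝔾ₘ ^ d` over `K` is the group algebra `K[ℤ ^ d]`, i.e. the ring of Laurent polynomials in
`d` variables, in which all monomials are group-like. -/
structure AlgebraicTorus.{u} (k : Type u) [Field k] (d : ℕ) where
  /-- The coordinate ring `k[T]`. -/
  coordRing : Type u
  [commRing : CommRing coordRing]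
  [hopfAlgebra : HopfAlgebra k coordRing]
  /-- `T` is isomorphic to `𝔾ₘ ^ d` over the algebraic closure. -/
  split : Nonempty ((AlgebraicClosure k ⊗[k] coordRing) ≃ₐc[AlgebraicClosure k]
    AddMonoidAlgebra (AlgebraicClosure k) (Fin d → ℤ))

namespace AlgebraicTorus

universe u

variable {k : Type u} [Field k] {d : ℕ}

attribute [instance] AlgebraicTorus.commRing AlgebraicTorus.hopfAlgebra

/-- The group `T(k)` of `k`-points: the `k`-algebra homomorphisms `k[T] → k`, with the
(convolution) product induced by the comultiplication of `k[T]`. -/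
abbrev Points (T : AlgebraicTorus k d) : Type u := WithConv (T.coordRing →ₐ[k] k)

/-- A torus is a commutative group scheme. -/
instance isCocomm (T : AlgebraicTorus k d) : Coalgebra.IsCocomm k T.coordRing := by
  obtain ⟨e⟩ := T.split
  let K := AlgebraicClosure k
  have hK : Coalgebra.IsCocomm K (K ⊗[k] T.coordRing) := by
    refine ⟨LinearMap.ext fun x ↦ ?_⟩
    apply (TensorProduct.congr e.toLinearEquiv e.toLinearEquiv).injective
    have h1 (y : (K ⊗[k] T.coordRing) ⊗[K] (K ⊗[k] T.coordRing)) :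
        TensorProduct.congr e.toLinearEquiv e.toLinearEquiv (TensorProduct.comm K _ _ y) =
          TensorProduct.comm K _ _ (TensorProduct.congr e.toLinearEquiv e.toLinearEquiv y) :=
      TensorProduct.map_comm e.toLinearEquiv.toLinearMap e.toLinearEquiv.toLinearMap y
    have h2 : TensorProduct.congr e.toLinearEquiv e.toLinearEquiv (Coalgebra.comul (R := K) x) =
        Coalgebra.comul (R := K) (e x) := CoalgHomClass.map_comp_comul_apply e x
    simp only [LinearMap.coe_comp, Function.comp_apply, LinearEquiv.coe_coe]
    rw [h1, h2, Coalgebra.comm_comul]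
  refine ⟨LinearMap.ext fun a ↦ ?_⟩
  let J := TensorProduct.AlgebraTensorModule.tensorTensorTensorComm k K k K K K
    T.coordRing T.coordRing
  have h3 (y : T.coordRing ⊗[k] T.coordRing) :
      TensorProduct.comm K _ _ (J (((1 : K) ⊗ₜ[K] (1 : K)) ⊗ₜ[k] y)) =
        J (((1 : K) ⊗ₜ[K] (1 : K)) ⊗ₜ[k] TensorProduct.comm k _ _ y) := by
    induction y with
    | zero => simp only [TensorProduct.tmul_zero, LinearEquiv.map_zero]
    | add a b ha hb => simp only [TensorProduct.tmul_add, LinearEquiv.map_add, ha, hb]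
    | tmul a b => rfl
  have h4 := Coalgebra.comm_comul K ((1 : K) ⊗ₜ[k] a)
  have h5 : Coalgebra.comul (R := K) ((1 : K) ⊗ₜ[k] a) =
      J (((1 : K) ⊗ₜ[K] (1 : K)) ⊗ₜ[k] Coalgebra.comul (R := k) a) := rfl
  rw [h5, h3] at h4
  have h6 := J.injective h4
  have h7 := congrArg (TensorProduct.congr ((TensorProduct.lid K K).restrictScalars k)
    (LinearEquiv.refl k (T.coordRing ⊗[k] T.coordRing))) h6
  simp only [TensorProduct.congr_tmul, LinearEquiv.restrictScalars_apply,
    TensorProduct.lid_tmul, one_smul, LinearEquiv.refl_apply] at h7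
  exact Module.FaithfullyFlat.tensorProduct_mk_injective (A := k) (B := K) _ h7

/-- The `p`-torsion subgroup `T(k)[p] = {x ∈ T(k) | x ^ p = 1}`. -/
noncomputable def pTorsion (T : AlgebraicTorus k d) (p : ℕ) : Subgroup T.Points :=
  (powMonoidHom p : T.Points →* T.Points).ker

end AlgebraicTorus

/-- `G` is a `p`-elementary group of rank `r`, i.e. `G ≅ (ℤ/p) ^ r`. -/
def IsElementaryOfRank (p : ℕ) (G : Type*) [Group G] (r : ℕ) : Prop :=
  Nonempty (G ≃* Multiplicative (Fin r → ZMod p))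

/-! Over the algebraic closure a torus is given by its character lattice ℤ^d, on which each Galois
automorphism acts through a matrix of finite order. The group Gal(k(ζ)/k) embeds in the cyclic group
𝔽_p^×, so it has a generator τ, and τ ζ = ζ^c with c of exact order t. Lift τ to σ and let s be the
action of σ on characters. A p-torsion k-point x takes p-th roots of unity as values on characters.
Writing these values as powers of ζ gives a functional f : ℤ^d → ℤ/p, and rationality of x forces f
∘ s = c f. So T(k)[p] embeds in a c-eigenspace, whose dimension is at most the multiplicity of c as
a root of the characteristic polynomial of s mod p.

That polynomial is integral and its roots are roots of unity. After s is replaced by a p-power of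
itself (c does not change, by Frobenius), their orders are prime to p. Then among the relevant
cyclotomic polynomials only Φ_t vanishes at c mod p, and only simply, so each occurrence of the root
c costs a factor Φ_t of degree φ(t). This is `rootMultiplicity_map_mul_totient_le`.

For sharpness, let τ act on ℤ[X]/(Φ_t)^r by multiplication by the class of X, and trivially on a
complement that brings the rank to d. Reduction X ↦ c supplies r independent eigenfunctionals. The
torus with this character lattice M represents the functor sending R to the equivariant
homomorphisms M → R ⊗ L, with L = k(ζ). Its Hopf structure comes from Yoneda, and it splits because
R ⊗ L ≅ ∏_g R for any R containing L. -/

/-! ### Eigenvalues mod p of integral matrices of finite order -/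

-- Induction on the degree, splitting off factors Φ_t. Each lowers the degree by φ(t) and the
-- multiplicity of c by at most one. Once Φ_t does not divide f, c is no longer a root mod p,
-- because X^N - 1 stays separable mod p and so its other cyclotomic factors do not vanish at c.
open Polynomial in
theorem rootMultiplicity_map_mul_totient_le {p : ℕ} [Fact p.Prime] {N t : ℕ} (hN : ¬ p ∣ N)
    (htN : t ∣ N) {c : ZMod p} (hc : IsPrimitiveRoot c t) (f : ℤ[X]) (hf : f.Monic)
    (hroots : ∀ z : ℂ, (f.map (Int.castRingHom ℂ)).IsRoot z → z ^ N = 1) :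
    (f.map (Int.castRingHom (ZMod p))).rootMultiplicity c * t.totient ≤ f.natDegree := by
  induction hn : f.natDegree using Nat.strong_induction_on generalizing f with
  | _ n ih =>
  have hN0 : 0 < N := Nat.pos_of_ne_zero (by rintro rfl; simp at hN)
  have ht0 : 0 < t := Nat.pos_of_dvd_of_pos htN hN0
  have hNp : (N : ZMod p) ≠ 0 := by rwa [Ne, ZMod.natCast_eq_zero_iff]
  have hsep : (X ^ N - 1 : (ZMod p)[X]).Separable := X_pow_sub_one_separable_iff.2 hNp
  set R : ℤ[X] := ∏ m ∈ N.divisors.erase t, cyclotomic m ℤ with hR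
  have hmul : cyclotomic t ℤ * R = X ^ N - 1 := by
    rw [hR, Finset.mul_prod_erase _ (fun m ↦ cyclotomic m ℤ) (Nat.mem_divisors.2 ⟨htN, hN0.ne'⟩),
      prod_cyclotomic_eq_X_pow_sub_one hN0]
  have hmulp : (cyclotomic t (ZMod p)) * R.map (Int.castRingHom (ZMod p)) = X ^ N - 1 := by
    rw [← map_cyclotomic_int, ← Polynomial.map_mul, hmul]; simp
  rw [← hmulp] at hsep
  by_cases hdvd : cyclotomic t ℤ ∣ f
  · obtain ⟨g, rfl⟩ := hdvd
    have hg : g.Monic := (cyclotomic.monic t ℤ).of_mul_monic_left hf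
    have hdeg : (cyclotomic t ℤ * g).natDegree = t.totient + g.natDegree := by
      rw [(cyclotomic.monic t ℤ).natDegree_mul hg, natDegree_cyclotomic]
    have htot : 0 < t.totient := Nat.totient_pos.2 ht0
    have h1 := ih g.natDegree (by omega) g hg (fun z hz ↦ hroots z (by
      rw [Polynomial.map_mul]; exact root_mul_left_of_isRoot _ hz)) rfl
    have h2 : rootMultiplicity c (cyclotomic t (ZMod p)) ≤ 1 :=
      rootMultiplicity_le_one_of_separable hsep.of_mul_left c
    rw [Polynomial.map_mul, rootMultiplicity_mul
      (mul_ne_zero ((cyclotomic.monic t ℤ).map _).ne_zero (hg.map _).ne_zero),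
      map_cyclotomic_int]
    nlinarith
  · have hroot : ∀ z : ℂ, (f.map (Int.castRingHom ℂ)).IsRoot z →
        (R.map (Int.castRingHom ℂ)).IsRoot z := by
      intro z hz
      have h1 : (cyclotomic t ℂ * R.map (Int.castRingHom ℂ)).IsRoot z := by
        rw [← map_cyclotomic_int, ← Polynomial.map_mul, hmul]
        simp [IsRoot, hroots z hz]
      rcases root_mul.1 h1 with h2 | h2
      · exfalso
        have : NeZero (t : ℂ) := ⟨by exact_mod_cast ht0.ne'⟩
        rw [isRoot_cyclotomic_iff] at h2
        apply hdvd
        rw [cyclotomic_eq_minpoly h2 ht0]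
        apply minpoly.isIntegrallyClosed_dvd (h2.isIntegral ht0)
        rw [aeval_def, ← eval_map]; exact hz
      · exact h2
    -- Over ℂ every linear factor of f divides R, so f divides R to the power of the number of
    -- factors. Monicity of f brings the divisibility down to ℤ.
    have hdvd2 : f ∣ R ^ Multiset.card (f.map (Int.castRingHom ℂ)).roots := by
      rw [← map_dvd_map (Int.castRingHom ℂ) Int.cast_injective hf, Polynomial.map_pow]
      conv_lhs => rw [(IsAlgClosed.splits (f.map (Int.castRingHom ℂ))).eq_prod_roots_of_monic
        (hf.map _)]
      rw [← Multiset.prod_replicate, ← Multiset.map_const']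
      apply Multiset.prod_dvd_prod_of_dvd
      intro z hz
      exact dvd_iff_isRoot.2 (hroot z (isRoot_of_mem_roots hz))
    have : rootMultiplicity c (f.map (Int.castRingHom (ZMod p))) = 0 := by
      apply rootMultiplicity_eq_zero
      intro h
      have h3 : (R.map (Int.castRingHom (ZMod p))).IsRoot c := by
        have := h.dvd (Polynomial.map_dvd (Int.castRingHom (ZMod p)) hdvd2)
        rw [Polynomial.map_pow, IsRoot, eval_pow] at this
        exact eq_zero_of_pow_eq_zero this
      have h4 : (cyclotomic t (ZMod p)).IsRoot c := hc.isRoot_cyclotomic ht0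
      obtain ⟨a, b, hab⟩ := hsep.isCoprime
      have := congrArg (eval c) hab
      rw [eval_add, eval_mul, eval_mul, h3.eq_zero, h4.eq_zero] at this
      simp at this
    simp [this]

/-- The functions `f : ℤ ^ d → ℤ/p` with `f ∘ s = c • f`. -/
def eigenFunctionals {p d : ℕ} (s : Module.End ℤ (Fin d → ℤ)) (c : ZMod p) :
    Submodule (ZMod p) ((Fin d → ℤ) →ₗ[ℤ] ZMod p) where
  carrier := {f | ∀ v, f (s v) = c * f v}
  zero_mem' := by simp
  add_mem' := by intro f g hf hg v; simp [hf v, hg v, mul_add]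
  smul_mem' := by intro a f hf v; simp [hf v, mul_left_comm]

instance {p d : ℕ} : Module.Finite (ZMod p) ((Fin d → ℤ) →ₗ[ℤ] ZMod p) :=
  Module.Finite.equiv (Module.Basis.constr (Pi.basisFun ℤ (Fin d)) (ZMod p))

theorem eigenFunctionals_le_pow {p d : ℕ} (s : Module.End ℤ (Fin d → ℤ)) (c : ZMod p) (n : ℕ) :
    eigenFunctionals s c ≤ eigenFunctionals (s ^ n) (c ^ n) := by
  intro f hf v
  induction n generalizing v with
  | zero => simp
  | succ n ih => rw [pow_succ, Module.End.mul_apply, ih, hf v, pow_succ, mul_assoc]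

-- Precomposition with s is the transposed matrix acting on coordinates of functionals. The
-- eigenspace dimension is therefore at most the multiplicity of c in the characteristic polynomial
-- mod p, whose integral lift has N-th roots of unity as its complex roots.
open Polynomial in
theorem finrank_eigenFunctionals_mul_totient_le_of_not_dvd {p : ℕ} [Fact p.Prime] {N t d : ℕ}
    (hN : ¬ p ∣ N) (htN : t ∣ N) {c : ZMod p} (hc : IsPrimitiveRoot c t)
    (s : Module.End ℤ (Fin d → ℤ)) (hs : s ^ N = 1) :
    Module.finrank (ZMod p) (eigenFunctionals s c) * t.totient ≤ d := by
  set B : Matrix (Fin d) (Fin d) ℤ := (LinearMap.toMatrixAlgEquiv' s).transpose with hB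
  have hBN : B ^ N = 1 := by
    rw [hB, ← Matrix.transpose_pow, ← map_pow, hs, map_one, Matrix.transpose_one]
  have hdeg : B.charpoly.natDegree = d := by simp [B.charpoly_natDegree_eq_dim]
  have key := rootMultiplicity_map_mul_totient_le hN htN hc B.charpoly B.charpoly_monic (by
    intro z hz
    rw [← Matrix.charpoly_map] at hz
    have h1 := spectrum.pow_mem_pow _ N (Matrix.mem_spectrum_of_isRoot_charpoly hz)
    have h2 : (Int.castRingHom ℂ).mapMatrix B ^ N = 1 := by rw [← map_pow, hBN, map_one]
    rw [RingHom.mapMatrix_apply] at h2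
    rw [h2, spectrum.mem_iff] at h1
    by_contra h3
    apply h1
    rw [← map_one (algebraMap ℂ (Matrix (Fin d) (Fin d) ℂ)), ← map_sub]
    exact (IsUnit.mk0 _ (sub_ne_zero.2 h3)).map _)
  rw [hdeg, ← Matrix.charpoly_map] at key
  refine le_trans (Nat.mul_le_mul_right _ ?_) key
  set C := B.map (Int.castRingHom (ZMod p)) with hC
  have h1 := LinearMap.finrank_eigenspace_le (Matrix.toLin' C) c
  rw [Matrix.charpoly_toLin'] at h1
  refine le_trans ?_ h1
  let φ : ((Fin d → ℤ) →ₗ[ℤ] ZMod p) →ₗ[ZMod p] (Fin d → ZMod p) :=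
    ((Pi.basisFun ℤ (Fin d)).constr (ZMod p)).symm.toLinearMap
  have hφ : Function.Injective φ := ((Pi.basisFun ℤ (Fin d)).constr (ZMod p)).symm.injective
  have hmem : ∀ f ∈ eigenFunctionals s c, φ f ∈ Module.End.eigenspace (Matrix.toLin' C) c := by
    intro f hf
    rw [Module.End.mem_eigenspace_iff]
    ext i
    have h2 : ∀ g j, φ g j = g (Pi.single j 1) := fun g j ↦ by
      rw [← Pi.basisFun_apply]
      exact (Pi.basisFun ℤ (Fin d)).constr_symm_apply (ZMod p) g j
    rw [Pi.smul_apply, h2, smul_eq_mul, ← hf, Matrix.toLin'_apply, Matrix.mulVec, dotProduct]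
    conv_rhs => rw [← Finset.univ_sum_single (s (Pi.single i 1)), map_sum]
    refine Finset.sum_congr rfl fun j _ ↦ ?_
    have h3 : (Pi.single j (s (Pi.single i 1) j) : Fin d → ℤ) =
        s (Pi.single i 1) j • Pi.single j 1 := by
      rw [← Pi.single_smul, smul_eq_mul, mul_one]
    rw [h2, h3, map_zsmul, zsmul_eq_mul]
    simp [hC, hB, LinearMap.toMatrixAlgEquiv'_apply]
  let ψ : eigenFunctionals s c →ₗ[ZMod p] Module.End.eigenspace (Matrix.toLin' C) c :=
    φ.restrict hmem
  exact LinearMap.finrank_le_finrank_of_injective (f := ψ)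
    (fun x y h ↦ Subtype.ext (hφ (congrArg Subtype.val h)))

theorem finrank_eigenFunctionals_mul_totient_le {p : ℕ} [Fact p.Prime] {N t d : ℕ}
    (hN : N ≠ 0) {c : ZMod p} (hc : IsPrimitiveRoot c t)
    (ht : ¬ p ∣ t)
    (s : Module.End ℤ (Fin d → ℤ)) (hs : s ^ N = 1) :
    Module.finrank (ZMod p) (eigenFunctionals s c) * t.totient ≤ d := by
  have hp : p.Prime := Fact.out
  obtain ⟨a, n, hn, rfl⟩ := Nat.exists_eq_pow_mul_and_not_dvd hN p hp.ne_one
  -- Passing to s^(p^a) removes the p-part of the order and keeps the eigenvalue, since c^(p^a) = c.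
  have h1 := eigenFunctionals_le_pow s c (p ^ a)
  rw [ZMod.pow_card_pow] at h1
  refine le_trans (Nat.mul_le_mul_right _ (Submodule.finrank_mono h1)) ?_
  -- The extra factor t only ensures that t divides the exponent.
  refine finrank_eigenFunctionals_mul_totient_le_of_not_dvd (N := n * t) ?_ (Dvd.intro_left _ rfl)
    hc _ ?_
  · rw [hp.dvd_mul]; tauto
  · rw [pow_mul, ← pow_mul s, hs, one_pow]

/-! ### Elementary p-groups and the Galois group of k(ζ) -/

/-- A commutative group that embeds into an `𝔽_p`-vector space `W` is `p`-elementary of rank at most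
`dim W`. -/
theorem exists_isElementaryOfRank_of_injective {p : ℕ} [Fact p.Prime] {G W : Type*} [CommGroup G]
    [AddCommGroup W] [Module (ZMod p) W] [Module.Finite (ZMod p) W] (φ : G →* Multiplicative W)
    (hφ : Function.Injective φ) :
    ∃ r ≤ Module.finrank (ZMod p) W, IsElementaryOfRank p G r := by
  let H : Submodule (ZMod p) W := AddSubgroup.toZModSubmodule p (MonoidHom.toAdditiveLeft φ).range
  refine ⟨Module.finrank (ZMod p) H, Submodule.finrank_le H, ⟨?_⟩⟩
  let e1 : Additive G ≃+ H := AddMonoidHom.ofInjective (f := MonoidHom.toAdditiveLeft φ) hφ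
  let e2 : H ≃+ (Fin (Module.finrank (ZMod p) H) → ZMod p) :=
    (Module.finBasis (ZMod p) H).equivFun.toAddEquiv
  exact AddEquiv.toMultiplicativeRight (e1.trans e2)

theorem IsElementaryOfRank.card {p r : ℕ} {G : Type*} [Group G] (h : IsElementaryOfRank p G r) :
    Nat.card G = p ^ r := by
  obtain ⟨e⟩ := h
  rw [Nat.card_congr e.toEquiv, Nat.card_congr Multiplicative.toAdd]
  simp [Nat.card_pi]

-- An automorphism is determined by its exponent on ζ, so the Galois group embeds in the cyclic
-- group (ℤ/p)^×. The exponent of a generator has order equal to the group order, which is the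
-- degree.
open scoped IntermediateField in
theorem IsPrimitiveRoot.exists_galois_generator {k K : Type*} [Field k] [Field K] [Algebra k K]
    [Algebra.IsIntegral k K]
    {p : ℕ} [Fact p.Prime] (hpk : (p : k) ≠ 0) {ζ : K} (hζ : IsPrimitiveRoot ζ p) :
    FiniteDimensional k k⟮ζ⟯ ∧ IsGalois k k⟮ζ⟯ ∧ ∃ (τ : k⟮ζ⟯ ≃ₐ[k] k⟮ζ⟯) (c : ZMod p),
      (∀ g, g ∈ Subgroup.zpowers τ) ∧ IsPrimitiveRoot c (Module.finrank k k⟮ζ⟯) ∧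
      τ (IntermediateField.AdjoinSimple.gen k ζ) =
        IntermediateField.AdjoinSimple.gen k ζ ^ c.val := by
  have hp : p.Prime := Fact.out
  have : NeZero (p : k) := ⟨hpk⟩
  have : NeZero p := ⟨hp.ne_zero⟩
  have hcyc : IsCyclotomicExtension {p} k k⟮ζ⟯ :=
    hζ.intermediateField_adjoin_isCyclotomicExtension k
  have hfin : FiniteDimensional k k⟮ζ⟯ := IsCyclotomicExtension.finiteDimensional {p} k _
  have hgal : IsGalois k k⟮ζ⟯ := IsCyclotomicExtension.isGalois {p} k _
  have hgen : IsPrimitiveRoot (IntermediateField.AdjoinSimple.gen k ζ) p := by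
    refine IsPrimitiveRoot.of_map_of_injective (f := algebraMap k⟮ζ⟯ K) ?_
      (algebraMap k⟮ζ⟯ K).injective
    simpa using hζ
  refine ⟨hfin, hgal, ?_⟩
  have hinj := hgen.autToPow_injective (K := k)
  have : IsCyclic (k⟮ζ⟯ ≃ₐ[k] k⟮ζ⟯) := isCyclic_of_injective _ hinj
  obtain ⟨τ, hτ⟩ := IsCyclic.exists_generator (α := k⟮ζ⟯ ≃ₐ[k] k⟮ζ⟯)
  refine ⟨τ, (hgen.autToPow k τ : (ZMod p)ˣ), hτ, ?_, (hgen.autToPow_spec k τ).symm⟩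
  rw [IsPrimitiveRoot.coe_units_iff, ← IsGalois.card_aut_eq_finrank,
    ← orderOf_eq_card_of_forall_mem_zpowers hτ, ← orderOf_injective _ hinj]
  exact IsPrimitiveRoot.orderOf _

theorem IsPrimitiveRoot.pow_mod {M : Type*} [CommMonoid M] {ζ : M} {n : ℕ}
    (hζ : IsPrimitiveRoot ζ n) (m : ℕ) : ζ ^ (m % n) = ζ ^ m := by
  rw [hζ.eq_orderOf, pow_mod_orderOf]

theorem IsPrimitiveRoot.pow_val_add {M : Type*} [CommMonoid M] {ζ : M} {n : ℕ} [NeZero n]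
    (hζ : IsPrimitiveRoot ζ n) (a b : ZMod n) : ζ ^ (a + b).val = ζ ^ a.val * ζ ^ b.val := by
  rw [ZMod.val_add, hζ.pow_mod, pow_add]

theorem IsPrimitiveRoot.pow_val_mul {M : Type*} [CommMonoid M] {ζ : M} {n : ℕ} [NeZero n]
    (hζ : IsPrimitiveRoot ζ n) (a b : ZMod n) : ζ ^ (a * b).val = (ζ ^ a.val) ^ b.val := by
  rw [ZMod.val_mul, hζ.pow_mod, pow_mul]

theorem IsPrimitiveRoot.pow_val_injective {M : Type*} [CommMonoid M] {ζ : M} {n : ℕ} [NeZero n]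
    (hζ : IsPrimitiveRoot ζ n) : Function.Injective fun a : ZMod n ↦ ζ ^ a.val :=
  fun a b h ↦ ZMod.val_injective n (hζ.pow_inj (ZMod.val_lt a) (ZMod.val_lt b) h)

/-! ### Galois action on K ⊗ A and base change of points -/

section GaloisAction

variable {k K A : Type*} [Field k] [Field K] [Algebra k K] [CommRing A]

section
variable [Algebra k A]

/-- The semilinear action `σ ⊗ 1` of `Gal(K/k)` on `K ⊗ A`. -/
noncomputable def galMap (A : Type*) [CommRing A] [Algebra k A] (σ : K ≃ₐ[k] K) :
    K ⊗[k] A →ₐ[k] K ⊗[k] A :=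
  Algebra.TensorProduct.map σ (AlgHom.id k A)

@[simp]
theorem galMap_tmul (σ : K ≃ₐ[k] K) (c : K) (a : A) :
    galMap A σ (c ⊗ₜ a) = σ c ⊗ₜ a := rfl

theorem galMap_mul (σ τ : K ≃ₐ[k] K) (h : K ⊗[k] A) :
    galMap A (σ * τ) h = galMap A σ (galMap A τ h) := by
  induction h with
  | zero => simp
  | add x y hx hy => simp only [map_add, hx, hy]
  | tmul c a => rfl

theorem galMap_one (h : K ⊗[k] A) : galMap A (1 : K ≃ₐ[k] K) h = h := by
  induction h with
  | zero => simp
  | add x y hx hy => simp only [map_add, hx, hy]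
  | tmul c a => rfl

theorem galMap_smul (σ : K ≃ₐ[k] K) (c : K) (h : K ⊗[k] A) :
    galMap A σ (c • h) = σ c • galMap A σ h := by
  induction h with
  | zero => simp
  | add x y hx hy => simp only [map_add, smul_add, hx, hy]
  | tmul b a => simp [TensorProduct.smul_tmul']

theorem galMap_pow_eq_self_of_dvd {σ : K ≃ₐ[k] K} {n m : ℕ} (hnm : n ∣ m) {h : K ⊗[k] A}
    (hn : galMap A (σ ^ n) h = h) : galMap A (σ ^ m) h = h := by
  obtain ⟨l, rfl⟩ := hnm
  induction l with
  | zero => simpa using galMap_one h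
  | succ l ih => rw [mul_add, pow_add, galMap_mul, mul_one, hn, ih]

/-- The orbit of c lies in the finite root set of its minimal polynomial. -/
theorem exists_pow_apply_eq_self [Algebra.IsAlgebraic k K] (σ : K ≃ₐ[k] K) (c : K) :
    ∃ n, 0 < n ∧ (σ ^ n) c = c := by
  have hc : minpoly k c ≠ 0 := minpoly.ne_zero (Algebra.IsAlgebraic.isAlgebraic c).isIntegral
  have hmem : ∀ n : ℕ, (σ ^ n) c ∈ (minpoly k c).rootSet K := fun n ↦ by
    rw [Polynomial.mem_rootSet_of_ne hc, ← AlgEquiv.coe_toAlgHom, Polynomial.aeval_algHom_apply,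
      minpoly.aeval, map_zero]
  obtain ⟨i, j, hij, h⟩ := Finite.exists_ne_map_eq_of_infinite
    (fun n : ℕ ↦ (⟨(σ ^ n) c, hmem n⟩ : (minpoly k c).rootSet K))
  have h' : (σ ^ i) c = (σ ^ j) c := congrArg Subtype.val h
  wlog hlt : i < j generalizing i j
  · exact this j i hij.symm h.symm h'.symm (by omega)
  refine ⟨j - i, by omega, (σ ^ i).injective ?_⟩
  rw [← AlgEquiv.mul_apply, ← pow_add, h']
  congr 3; omega

theorem exists_galMap_pow_eq_self [Algebra.IsAlgebraic k K] (σ : K ≃ₐ[k] K) (h : K ⊗[k] A) :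
    ∃ n, 0 < n ∧ galMap A (σ ^ n) h = h := by
  induction h with
  | zero => exact ⟨1, one_pos, by simp⟩
  | add x y hx hy =>
    obtain ⟨n, hn, hx⟩ := hx
    obtain ⟨m, hm, hy⟩ := hy
    refine ⟨n * m, Nat.mul_pos hn hm, ?_⟩
    rw [map_add, galMap_pow_eq_self_of_dvd (Dvd.intro _ rfl) hx,
      galMap_pow_eq_self_of_dvd (Dvd.intro_left _ rfl) hy]
  | tmul c a =>
    obtain ⟨n, hn, h⟩ := exists_pow_apply_eq_self σ c
    exact ⟨n, hn, by rw [galMap_tmul, h]⟩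

end

variable [Bialgebra k A]

theorem comul_tmul_eq_sum (c : K) {a : A} {ι : Type*} (r : Coalgebra.Repr k a ι) :
    Coalgebra.comul (R := K) (c ⊗ₜ[k] a) =
      ∑ i ∈ r.index, (c ⊗ₜ[k] r.left i) ⊗ₜ[K] ((1 : K) ⊗ₜ[k] r.right i) := by
  have h1 : Coalgebra.comul (R := K) ((1 : K) ⊗ₜ[k] a) =
      ∑ i ∈ r.index, ((1 : K) ⊗ₜ[k] r.left i) ⊗ₜ[K] ((1 : K) ⊗ₜ[k] r.right i) := by
    simp [TensorProduct.comul_tmul, ← r.eq, TensorProduct.tmul_sum]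
  rw [← mul_one c, ← smul_eq_mul, ← TensorProduct.smul_tmul', map_smul, h1, Finset.smul_sum]
  exact Finset.sum_congr rfl fun i _ ↦ by
    rw [TensorProduct.smul_tmul', TensorProduct.smul_tmul']

/-- The coalgebra structure is defined over k, so the semilinear action commutes with counit and
comultiplication. This makes the Galois group act on characters. -/
theorem IsGroupLikeElem.galMap (σ : K ≃ₐ[k] K) {h : K ⊗[k] A} (hh : IsGroupLikeElem K h) :
    IsGroupLikeElem K (galMap A σ h) := by
  let S : K ⊗[k] A →ₛₗ[(σ : K →+* K)] K ⊗[k] A :=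
    { (_root_.galMap A σ).toLinearMap.toAddMonoidHom with map_smul' := galMap_smul σ }
  have h1 : ∀ x, Coalgebra.counit (R := K) (_root_.galMap A σ x) =
      σ (Coalgebra.counit (R := K) x) := by
    intro x
    induction x with
    | zero => simp
    | add x y hx hy => simp only [map_add, hx, hy]
    | tmul c a => simp [Algebra.smul_def]
  have h2 : ∀ x, Coalgebra.comul (R := K) (_root_.galMap A σ x) =
      TensorProduct.map S S (Coalgebra.comul (R := K) x) := by
    intro x
    induction x with
    | zero => simp
    | add x y hx hy => simp only [map_add, hx, hy]
    | tmul c a =>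
      rw [galMap_tmul, comul_tmul_eq_sum _ (Coalgebra.Repr.arbitrary k a),
        comul_tmul_eq_sum _ (Coalgebra.Repr.arbitrary k a), map_sum]
      refine Finset.sum_congr rfl fun i _ ↦ ?_
      rw [TensorProduct.map_tmul]
      change _ = (_root_.galMap A σ _) ⊗ₜ (_root_.galMap A σ _)
      simp
  refine ⟨?_, ?_⟩
  · rw [h1, hh.counit_eq_one, map_one]
  · rw [h2, hh.comul_eq_tmul_self]; rfl

/-- The base change to `K` of a `k`-point. -/
noncomputable def basePoint (K : Type*) [Field K] [Algebra k K] (x : A →ₐ[k] k) :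
    K ⊗[k] A →ₐ[K] K :=
  Algebra.TensorProduct.lift (Algebra.ofId K K) ((Algebra.ofId k K).comp x)
    fun _ _ ↦ Commute.all _ _

@[simp]
theorem basePoint_tmul (x : A →ₐ[k] k) (c : K) (a : A) :
    basePoint K x (c ⊗ₜ a) = c * algebraMap k K (x a) := rfl

theorem basePoint_galMap (x : A →ₐ[k] k) (σ : K ≃ₐ[k] K) (h : K ⊗[k] A) :
    basePoint K x (galMap A σ h) = σ (basePoint K x h) := by
  induction h with
  | zero => simp
  | add x y hx hy => simp only [map_add, hx, hy]
  | tmul c a => simp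

theorem basePoint_injective : Function.Injective (basePoint (k := k) (A := A) K) := by
  intro x y h
  ext a
  apply (algebraMap k K).injective
  simpa using DFunLike.congr_fun h (1 ⊗ₜ a)

/-- The comultiplication of a group-like h is h ⊗ h, so convolution of points becomes multiplication
of values. -/
theorem basePoint_mul_apply (x y : WithConv (A →ₐ[k] k)) {h : K ⊗[k] A}
    (hh : IsGroupLikeElem K h) :
    basePoint K (x * y).ofConv h = basePoint K x.ofConv h * basePoint K y.ofConv h := by
  have h2 : ∀ h, basePoint K (x * y).ofConv h = LinearMap.mul' K K
      (TensorProduct.map (basePoint K x.ofConv).toLinearMap (basePoint K y.ofConv).toLinearMap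
        (Coalgebra.comul (R := K) h)) := by
    intro h
    induction h with
    | zero => simp
    | add x y hx hy => simp only [map_add, hx, hy]
    | tmul c a =>
      let r := Coalgebra.Repr.arbitrary k a
      have h3 : (x * y).ofConv a = ∑ i ∈ r.index, x (r.left i) * y (r.right i) := by
        change (x * y) a = _
        rw [AlgHom.convMul_apply, ← r.eq, map_sum]
        rfl
      rw [comul_tmul_eq_sum _ r, basePoint_tmul, h3]
      simp [Finset.mul_sum, mul_assoc]
  rw [h2, hh.comul_eq_tmul_self]
  rfl

theorem basePoint_one_apply {h : K ⊗[k] A} (hh : IsGroupLikeElem K h) :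
    basePoint K (1 : WithConv (A →ₐ[k] k)).ofConv h = 1 := by
  have h2 : ∀ h, basePoint K (1 : WithConv (A →ₐ[k] k)).ofConv h =
      Coalgebra.counit (R := K) h := by
    intro h
    induction h with
    | zero => simp
    | add x y hx hy => simp only [map_add, hx, hy]
    | tmul c a =>
      rw [basePoint_tmul, TensorProduct.counit_tmul, Algebra.smul_def, mul_comm]
      rfl
  rw [h2, hh.counit_eq_one]

theorem basePoint_pow_apply (x : WithConv (A →ₐ[k] k)) {h : K ⊗[k] A}
    (hh : IsGroupLikeElem K h) (n : ℕ) :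
    basePoint K (x ^ n).ofConv h = basePoint K x.ofConv h ^ n := by
  induction n with
  | zero => simpa using basePoint_one_apply hh
  | succ n ih => rw [pow_succ, basePoint_mul_apply _ _ hh, ih, pow_succ]

end GaloisAction

/-! ### Character lattice and the upper bound -/

open scoped IntermediateField

namespace AlgebraicTorus

universe u

variable {k : Type u} [Field k] {d : ℕ}

/-- The characters of a torus over the algebraic closure form a lattice `ℤ ^ d` on which each
element of the Galois group acts through a matrix of finite order. -/
theorem exists_character_lattice (T : AlgebraicTorus k d)
    (σ : AlgebraicClosure k ≃ₐ[k] AlgebraicClosure k) :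
    ∃ (g : (Fin d → ℤ) → AlgebraicClosure k ⊗[k] T.coordRing) (s : Module.End ℤ (Fin d → ℤ))
      (N : ℕ), (∀ v, IsGroupLikeElem (AlgebraicClosure k) (g v)) ∧
      (∀ v w, g (v + w) = g v * g w) ∧ Submodule.span (AlgebraicClosure k) (Set.range g) = ⊤ ∧
      (∀ v, galMap T.coordRing σ (g v) = g (s v)) ∧ N ≠ 0 ∧ s ^ N = 1 := by
  classical
  let K := AlgebraicClosure k
  obtain ⟨e⟩ := T.split
  let g : (Fin d → ℤ) → K ⊗[k] T.coordRing := fun v ↦ e.symm (AddMonoidAlgebra.single v 1)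
  have hg1 : ∀ v, IsGroupLikeElem K (g v) := fun v ↦
    (AddMonoidAlgebra.isGroupLikeElem_single_one v).map e.symm
  have hg2 : ∀ v w, g (v + w) = g v * g w := fun v w ↦ by
    change e.symm _ = e.symm _ * e.symm _
    rw [← map_mul, AddMonoidAlgebra.single_mul_single, one_mul]
  have hinj : Function.Injective g := e.symm.injective.comp fun v w h ↦ by
    exact AddMonoidAlgebra.single_left_injective one_ne_zero h
  -- The group-like elements of K[ℤ^d] are exactly the monomials.
  have hsurj : ∀ h, IsGroupLikeElem K h → ∃ v, g v = h := fun h hh ↦ by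
    obtain ⟨v, hv⟩ := AddMonoidAlgebra.isGroupLikeElem_iff_mem_range_of.1 (hh.map e)
    refine ⟨v.toAdd, ?_⟩
    rw [← e.symm_apply_apply h, ← hv]
    rfl
  have hspan : Submodule.span K (Set.range g) = ⊤ := by
    refine eq_top_iff.2 fun h _ ↦ ?_
    suffices H : ∀ y ∈ Submodule.span K {a : AddMonoidAlgebra K (Fin d → ℤ) | IsGroupLikeElem K a},
        e.symm y ∈ Submodule.span K (Set.range g) by
      rw [← e.symm_apply_apply h]
      exact H _ (by rw [AddMonoidAlgebra.span_isGroupLikeElem]; trivial)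
    intro y hy
    induction hy using Submodule.span_induction with
    | mem y hy =>
      obtain ⟨v, hv⟩ := hsurj _ (hy.map e.symm)
      exact Submodule.subset_span ⟨v, hv⟩
    | zero => simp
    | add x y _ _ hx hy => rw [map_add]; exact add_mem hx hy
    | smul c x _ hx => rw [map_smul]; exact Submodule.smul_mem _ c hx
  choose s hs using fun v ↦ hsurj _ ((hg1 v).galMap σ)
  have hadd : ∀ v w, s (v + w) = s v + s w := fun v w ↦ hinj (by
    rw [hs, hg2, hg2, hs, hs, map_mul])
  let S : Module.End ℤ (Fin d → ℤ) := (AddMonoidHom.mk' s hadd).toIntLinearMap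
  have hS : ∀ v, galMap T.coordRing σ (g v) = g (S v) := fun v ↦ (hs v).symm
  have hSpow : ∀ n v, galMap T.coordRing (σ ^ n) (g v) = g ((S ^ n) v) := fun n v ↦ by
    induction n with
    | zero => exact galMap_one _
    | succ n ih => rw [pow_succ', galMap_mul, ih, hS, pow_succ', Module.End.mul_apply]
  -- σ itself may have infinite order, but some power of it fixes each of the d basis characters.
  -- The product of these exponents works for all of them.
  choose n hn0 hn using fun i ↦ exists_galMap_pow_eq_self σ (g (Pi.single i 1))
  refine ⟨g, S, ∏ i, n i, hg1, hg2, hspan, hS, (Finset.prod_pos fun i _ ↦ hn0 i).ne', ?_⟩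
  refine (Pi.basisFun ℤ (Fin d)).ext fun i ↦ hinj ?_
  rw [Pi.basisFun_apply, ← hSpow]
  exact galMap_pow_eq_self_of_dvd (Finset.dvd_prod_of_mem _ (Finset.mem_univ i)) (hn i)

/-- The logarithm to base ζ of the values on characters embeds T(k)[p] in the c-eigenfunctionals. It
is injective because the characters span the coordinate ring over the algebraic closure. -/
theorem exists_isElementaryOfRank_pTorsion_le (T : AlgebraicTorus k d) {p : ℕ} [Fact p.Prime]
    (hpk : (p : k) ≠ 0) {ζ : AlgebraicClosure k} (hζ : IsPrimitiveRoot ζ p) :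
    ∃ r : ℕ, IsElementaryOfRank p (T.pTorsion p) r ∧
      r * (Module.finrank k k⟮ζ⟯).totient ≤ d := by
  have hp : p.Prime := Fact.out
  have : NeZero p := ⟨hp.ne_zero⟩
  let K := AlgebraicClosure k
  obtain ⟨_, _, τ, c, -, hc, hτ⟩ := hζ.exists_galois_generator hpk
  obtain ⟨σ, rfl⟩ := AlgEquiv.restrictNormalHom_surjective (F := k) (K₁ := k⟮ζ⟯) K τ
  have hσ : σ ζ = ζ ^ c.val := by
    have := congrArg (algebraMap k⟮ζ⟯ K) hτ
    erw [AlgEquiv.restrictNormal_commutes] at this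
    rw [map_pow] at this
    exact this
  obtain ⟨g, s, N, hg1, hg2, hspan, hs, hN, hsN⟩ := T.exists_character_lattice σ
  -- The degree is the order of c in 𝔽_p^×, hence divides p - 1.
  have hpt : ¬ p ∣ Module.finrank k k⟮ζ⟯ := by
    have hc0 : c ≠ 0 := by
      rintro rfl
      exact absurd (hc.isUnit Module.finrank_pos.ne') not_isUnit_zero
    have h1 := Nat.le_of_dvd (Nat.sub_pos_of_lt hp.one_lt)
      (hc.dvd_of_pow_eq_one _ (ZMod.pow_card_sub_one_eq_one hc0))
    exact Nat.not_dvd_of_pos_of_lt Module.finrank_pos (by have := hp.pos; omega)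
  have key := finrank_eigenFunctionals_mul_totient_le hN hc hpt s hsN
  have hlog : ∀ y : K, y ^ p = 1 → ∃ a : ZMod p, ζ ^ a.val = y := fun y hy ↦ by
    obtain ⟨i, hi, h⟩ := hζ.eq_pow_of_pow_eq_one hy
    exact ⟨i, by rw [ZMod.val_natCast_of_lt hi, h]⟩
  have hval_inj := hζ.pow_val_injective
  choose f hf using fun (x : T.pTorsion p) v ↦ hlog (basePoint K x.1.ofConv (g v)) (by
    rw [← basePoint_pow_apply _ (hg1 v)]
    have hx : x.1 ^ p = 1 := x.2
    rw [hx, basePoint_one_apply (hg1 v)])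
  have hfadd : ∀ x v w, f x (v + w) = f x v + f x w := fun x v w ↦ hval_inj (by
    simp only [hζ.pow_val_add, hf, hg2, map_mul])
  let F : T.pTorsion p → (Fin d → ℤ) →ₗ[ℤ] ZMod p := fun x ↦
    (AddMonoidHom.mk' (f x) (hfadd x)).toIntLinearMap
  have hFmem : ∀ x, F x ∈ eigenFunctionals s c := fun x v ↦ hval_inj (by
    change ζ ^ (f x (s v)).val = ζ ^ (c * f x v).val
    rw [hf, ← hs, basePoint_galMap, ← hf, map_pow, hσ, hζ.pow_val_mul])
  have hFmul : ∀ x y, F (x * y) = F x + F y := fun x y ↦ LinearMap.ext fun v ↦ hval_inj (by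
    change ζ ^ (f (x * y) v).val = ζ ^ (f x v + f y v).val
    simp only [hζ.pow_val_add, hf]
    exact basePoint_mul_apply _ _ (hg1 v))
  have hFinj : Function.Injective F := fun x y h ↦ by
    apply Subtype.ext
    apply WithConv.ext
    apply basePoint_injective (K := K)
    apply AlgHom.toLinearMap_injective
    apply LinearMap.ext_on_range (v := g) hspan
    intro v
    have h1 : f x v = f y v := DFunLike.congr_fun h v
    change basePoint K x.1.ofConv (g v) = basePoint K y.1.ofConv (g v)
    rw [← hf, ← hf, h1]
  obtain ⟨r, hr, h⟩ := exists_isElementaryOfRank_of_injective (p := p)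
    (MonoidHom.mk' (fun x ↦ Multiplicative.ofAdd (⟨F x, hFmem x⟩ : eigenFunctionals s c))
      fun x y ↦ by rw [← ofAdd_add]; congr 1; exact Subtype.ext (hFmul x y))
    fun x y h ↦ hFinj (congrArg Subtype.val (Multiplicative.ofAdd.injective h))
  exact ⟨r, h, (Nat.mul_le_mul_right _ hr).trans key⟩

end AlgebraicTorus

/-! ### The functor of points attached to a Galois lattice -/

section TorusFunctor

universe u

variable {k L : Type u} [Field k] [Field L] [Algebra k L]
variable {R S Q : Type u} [CommRing R] [CommRing S] [CommRing Q] [Algebra k R] [Algebra k S]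
  [Algebra k Q]
variable {M : Type} [CommGroup M]

/-- The action `1 ⊗ g` of `Gal(L/k)` on `R ⊗ L`. -/
noncomputable def galRight (R : Type u) [CommRing R] [Algebra k R] (g : L ≃ₐ[k] L) :
    R ⊗[k] L →ₐ[k] R ⊗[k] L :=
  Algebra.TensorProduct.map (AlgHom.id k R) g

@[simp]
theorem galRight_tmul (g : L ≃ₐ[k] L) (r : R) (l : L) : galRight R g (r ⊗ₜ l) = r ⊗ₜ g l := rfl

theorem galRight_mul (g h : L ≃ₐ[k] L) (z : R ⊗[k] L) :
    galRight R (g * h) z = galRight R g (galRight R h z) := by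
  induction z with
  | zero => simp
  | add x y hx hy => simp only [map_add, hx, hy]
  | tmul r l => rfl

theorem galRight_one (z : R ⊗[k] L) : galRight R (1 : L ≃ₐ[k] L) z = z := by
  induction z with
  | zero => simp
  | add x y hx hy => simp only [map_add, hx, hy]
  | tmul r l => rfl

/-- The map `f ⊗ 1 : R ⊗ L → S ⊗ L`. -/
noncomputable def mapLeft (L : Type u) [Field L] [Algebra k L] (f : R →ₐ[k] S) :
    R ⊗[k] L →ₐ[k] S ⊗[k] L :=
  Algebra.TensorProduct.map f (AlgHom.id k L)

@[simp]
theorem mapLeft_tmul (f : R →ₐ[k] S) (r : R) (l : L) : mapLeft L f (r ⊗ₜ l) = f r ⊗ₜ l := rfl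

theorem mapLeft_comp_apply (f : R →ₐ[k] S) (g : S →ₐ[k] Q) (z : R ⊗[k] L) :
    mapLeft L (g.comp f) z = mapLeft L g (mapLeft L f z) := by
  induction z with
  | zero => simp
  | add x y hx hy => simp only [map_add, hx, hy]
  | tmul r l => rfl

theorem mapLeft_id_apply (z : R ⊗[k] L) : mapLeft L (AlgHom.id k R) z = z := by
  induction z with
  | zero => simp
  | add x y hx hy => simp only [map_add, hx, hy]
  | tmul r l => rfl

theorem mapLeft_galRight (f : R →ₐ[k] S) (g : L ≃ₐ[k] L) (z : R ⊗[k] L) :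
    mapLeft L f (galRight R g z) = galRight S g (mapLeft L f z) := by
  induction z with
  | zero => simp
  | add x y hx hy => simp only [map_add, hx, hy]
  | tmul r l => rfl

/-- Coordinates along a basis of L are natural in R, so equations in R ⊗ L become polynomial
equations over k. -/
theorem baseChange_repr_mapLeft {ι : Type*} (b : Module.Basis ι k L) (f : R →ₐ[k] S)
    (z : R ⊗[k] L) (i : ι) :
    (b.baseChange S).repr (mapLeft L f z) i = f ((b.baseChange R).repr z i) := by
  induction z with
  | zero => simp
  | add x y hx hy => simp only [map_add, Finsupp.add_apply, hx, hy]
  | tmul r l => simp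

/-- The functor of points of the torus that is split by `L` and has character lattice `M`, with
`Gal(L/k)` acting through `ρ`: its `R`-points are the equivariant homomorphisms from `M` to
`R ⊗ L`. -/
noncomputable def torusPoints (ρ : (L ≃ₐ[k] L) →* MulAut M) (R : Type u) [CommRing R]
    [Algebra k R] : Submonoid (M →* R ⊗[k] L) where
  carrier := {m | ∀ g x, m (ρ g x) = galRight R g (m x)}
  one_mem' := fun g x ↦ by simp
  mul_mem' := fun {m n} hm hn g x ↦ by simp [hm g x, hn g x]

variable {ρ : (L ≃ₐ[k] L) →* MulAut M}

namespace torusPoints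

@[ext]
theorem ext {m n : torusPoints ρ R} (h : ∀ x, m.1 x = n.1 x) : m = n :=
  Subtype.ext (MonoidHom.ext h)

/-- Functoriality of the points of a torus. -/
noncomputable def map (f : R →ₐ[k] S) : torusPoints ρ R →* torusPoints ρ S where
  toFun m := ⟨(mapLeft L f : R ⊗[k] L →* S ⊗[k] L).comp m.1, fun g x ↦ by
    simp [m.2 g x, mapLeft_galRight]⟩
  map_one' := by ext x; simp
  map_mul' m n := by ext x; simp

@[simp]
theorem map_val_apply (f : R →ₐ[k] S) (m : torusPoints ρ R) (x : M) :
    (map f m).1 x = mapLeft L f (m.1 x) := rfl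

theorem map_comp (f : R →ₐ[k] S) (g : S →ₐ[k] Q) (m : torusPoints ρ R) :
    map (g.comp f) m = map g (map f m) := by
  ext x; exact mapLeft_comp_apply f g _

theorem map_id (m : torusPoints ρ R) : map (AlgHom.id k R) m = m := by
  ext x; exact mapLeft_id_apply _

/-- The inverse of a point. -/
def inv (m : torusPoints ρ R) : torusPoints ρ R :=
  ⟨m.1.comp (invMonoidHom : M →* M), fun g x ↦ by
    simpa using m.2 g x⁻¹⟩

theorem inv_mul (m : torusPoints ρ R) : inv m * m = 1 := by
  ext x
  change m.1 x⁻¹ * m.1 x = 1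
  rw [← map_mul, inv_mul_cancel, map_one]

/-- A point over `A` is universal if it exhibits `A` as representing the functor of points. -/
def IsUniversal {A : Type u} [CommRing A] [Algebra k A] (u : torusPoints ρ A) : Prop :=
  ∀ (R : Type u) [CommRing R] [Algebra k R] (m : torusPoints ρ R), ∃! f : A →ₐ[k] R, map f u = m

/-- Take one variable for each coordinate of the image of each element of M, and divide by the
coordinates of the relations for multiplicativity, unit and equivariance. -/
theorem exists_isUniversal [FiniteDimensional k L] (ρ : (L ≃ₐ[k] L) →* MulAut M) :
    ∃ (A : Type u) (_ : CommRing A) (_ : Algebra k A) (u : torusPoints ρ A), IsUniversal u := by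
  classical
  let b := Module.finBasis k L
  let P := MvPolynomial (M × Fin (Module.finrank k L)) k
  let U : M → P ⊗[k] L := fun x ↦ ∑ j, MvPolynomial.X (x, j) ⊗ₜ b j
  have hU : ∀ (R : Type u) [CommRing R] [Algebra k R] (f : P →ₐ[k] R) x j,
      (b.baseChange R).repr (mapLeft L f (U x)) j = f (MvPolynomial.X (x, j)) := by
    intro R _ _ f x j
    rw [baseChange_repr_mapLeft]
    simp [U, Finsupp.single_apply]
  let Z : Set (P ⊗[k] L) := Set.range (fun x : M × M ↦ U (x.1 * x.2) - U x.1 * U x.2) ∪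
    ({U 1 - 1} ∪ Set.range (fun x : (L ≃ₐ[k] L) × M ↦ U (ρ x.1 x.2) - galRight P x.1 (U x.2)))
  let I : Ideal P := Ideal.span {y | ∃ z ∈ Z, ∃ j, y = (b.baseChange P).repr z j}
  let q : P →ₐ[k] P ⧸ I := Ideal.Quotient.mkₐ k I
  have hq : ∀ z ∈ Z, mapLeft L q z = 0 := by
    intro z hz
    apply (b.baseChange (P ⧸ I)).repr.injective
    ext j
    rw [baseChange_repr_mapLeft, map_zero, Finsupp.zero_apply]
    exact Ideal.Quotient.eq_zero_iff_mem.2 (Ideal.subset_span ⟨z, hz, j, rfl⟩)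
  let u : torusPoints ρ (P ⧸ I) := ⟨
    { toFun x := mapLeft L q (U x)
      map_one' := by
        have := hq (U 1 - 1) (Or.inr (Or.inl rfl))
        rwa [map_sub, map_one, sub_eq_zero] at this
      map_mul' x y := by
        have := hq _ (Or.inl ⟨(x, y), rfl⟩)
        rwa [map_sub, map_mul, sub_eq_zero] at this }, fun g x ↦ by
    have := hq _ (Or.inr (Or.inr ⟨(g, x), rfl⟩))
    rwa [map_sub, mapLeft_galRight, sub_eq_zero] at this⟩
  refine ⟨P ⧸ I, inferInstance, inferInstance, u, fun R _ _ m ↦ ?_⟩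
  let f : P →ₐ[k] R := MvPolynomial.aeval fun x ↦ (b.baseChange R).repr (m.1 x.1) x.2
  have hf : ∀ x, mapLeft L f (U x) = m.1 x := fun x ↦ by
    apply (b.baseChange R).repr.injective
    ext j
    rw [hU]
    exact MvPolynomial.aeval_X _ _
  have hfI : ∀ y ∈ I, f y = 0 := by
    suffices I ≤ RingHom.ker f from this
    rw [Ideal.span_le]
    rintro y ⟨z, hz, j, rfl⟩
    have h0 : mapLeft L f z = 0 := by
      rcases hz with ⟨⟨x, y⟩, rfl⟩ | rfl | ⟨⟨g, x⟩, rfl⟩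
      · simp [hf]
      · simp [hf]
      · simp [hf, mapLeft_galRight, m.2 g x]
    change f _ = 0
    rw [← baseChange_repr_mapLeft, h0, map_zero, Finsupp.zero_apply]
  refine ⟨Ideal.Quotient.liftₐ I f hfI, ?_, ?_⟩
  · ext x
    change mapLeft L _ (mapLeft L q (U x)) = _
    rw [← mapLeft_comp_apply, ← hf]
    rfl
  · intro f' hf'
    apply Ideal.Quotient.algHom_ext
    apply MvPolynomial.algHom_ext
    rintro ⟨x, j⟩
    change (f'.comp q) _ = _
    rw [← hU, mapLeft_comp_apply]
    have : mapLeft L f' (mapLeft L q (U x)) = m.1 x := by rw [← hf']; rfl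
    rw [this]
    change _ = f (MvPolynomial.X (x, j))
    rw [← hf, hU]

namespace IsUniversal

variable {A : Type u} [CommRing A] [Algebra k A] {u : torusPoints ρ A}

theorem hom_ext (hu : IsUniversal u) {f g : A →ₐ[k] R} (h : map f u = map g u) : f = g :=
  (hu R (map g u)).unique h rfl

end IsUniversal

end torusPoints

end TorusFunctor

/-! ### Hopf algebra structure by Yoneda -/

namespace torusPoints
universe u

variable {k L : Type u} [Field k] [Field L] [Algebra k L]
variable {M : Type} [CommGroup M] {ρ : (L ≃ₐ[k] L) →* MulAut M}
variable {A Q Q' : Type u} [CommRing A] [Algebra k A] [CommRing Q] [Algebra k Q] [CommRing Q']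
  [Algebra k Q'] {u : torusPoints ρ A}

namespace IsUniversal
open Algebra.TensorProduct

theorem map_lift {Δ : A →ₐ[k] A ⊗[k] A}
    (hΔ : map Δ u = map (includeLeft : A →ₐ[k] A ⊗[k] A) u *
      map (includeRight : A →ₐ[k] A ⊗[k] A) u) (f g : A →ₐ[k] Q)
    (h : ∀ x y, Commute (f x) (g y)) :
    map ((Algebra.TensorProduct.lift f g h).comp Δ) u = map f u * map g u := by
  have h1 : (Algebra.TensorProduct.lift f g h).comp includeLeft = f := AlgHom.ext fun x ↦ by simp
  have h2 : (Algebra.TensorProduct.lift f g h).comp includeRight = g := AlgHom.ext fun x ↦ by simp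
  rw [map_comp, hΔ, map_mul, ← map_comp, ← map_comp, h1, h2]

theorem map_map {Δ : A →ₐ[k] A ⊗[k] A}
    (hΔ : map Δ u = map (includeLeft : A →ₐ[k] A ⊗[k] A) u *
      map (includeRight : A →ₐ[k] A ⊗[k] A) u) (f : A →ₐ[k] Q) (g : A →ₐ[k] Q') :
    map ((Algebra.TensorProduct.map f g).comp Δ) u =
      map ((includeLeft : Q →ₐ[k] Q ⊗[k] Q').comp f) u *
        map ((includeRight : Q' →ₐ[k] Q ⊗[k] Q').comp g) u := by
  have h1 : (Algebra.TensorProduct.map f g).comp includeLeft =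
    (includeLeft : Q →ₐ[k] Q ⊗[k] Q').comp f := AlgHom.ext fun x ↦ by simp
  have h2 : (Algebra.TensorProduct.map f g).comp includeRight =
    (includeRight : Q' →ₐ[k] Q ⊗[k] Q').comp g := AlgHom.ext fun x ↦ by simp
  rw [map_comp, hΔ, map_mul, ← map_comp, ← map_comp, h1, h2]

/-- Coassociativity with B₂, B₃, B₃' in the roles of A ⊗ A, (A ⊗ A) ⊗ A, A ⊗ (A ⊗ A). Both
composites send u to the product of its three pullbacks, bracketed differently, and universality
makes them equal. -/
theorem comp_comp_eq_comp (hu : IsUniversal u) {B₂ B₃ B₃' : Type u} [CommRing B₂] [CommRing B₃]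
    [CommRing B₃'] [Algebra k B₂] [Algebra k B₃] [Algebra k B₃'] {Δ l r : A →ₐ[k] B₂}
    (hΔ : map Δ u = map l u * map r u) {l' : B₂ →ₐ[k] B₃} {r' : A →ₐ[k] B₃}
    {l'' : A →ₐ[k] B₃'} {r'' : B₂ →ₐ[k] B₃'} {α : B₃ →ₐ[k] B₃'} {f : B₂ →ₐ[k] B₃}
    {g : B₂ →ₐ[k] B₃'} (hfl : f.comp l = l'.comp Δ) (hfr : f.comp r = r') (hgl : g.comp l = l'')
    (hgr : g.comp r = r''.comp Δ) (h1 : (α.comp l').comp l = l'')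
    (h2 : (α.comp l').comp r = r''.comp l) (h3 : α.comp r' = r''.comp r) :
    α.comp (f.comp Δ) = g.comp Δ := by
  apply hu.hom_ext
  calc map (α.comp (f.comp Δ)) u = map α (map (l'.comp Δ) u * map r' u) := by
        rw [map_comp, map_comp, hΔ, map_mul, ← map_comp, ← map_comp, hfl, hfr]
    _ = map ((α.comp l').comp l) u * map ((α.comp l').comp r) u * map (α.comp r') u := by
        rw [map_mul, map_comp Δ l', hΔ, ← map_comp, ← map_comp, map_mul, ← map_comp, ← map_comp]
    _ = map l'' u * map (r''.comp Δ) u := by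
        rw [h1, h2, h3, map_comp Δ r'', hΔ, map_mul, ← map_comp, ← map_comp, mul_assoc]
    _ = map (g.comp Δ) u := by
        rw [map_comp Δ g, hΔ, map_mul, ← map_comp, ← map_comp, hgl, hgr]

theorem coassoc (hu : IsUniversal u) {Δ : A →ₐ[k] A ⊗[k] A}
    (hΔ : map Δ u = map (includeLeft : A →ₐ[k] A ⊗[k] A) u *
      map (includeRight : A →ₐ[k] A ⊗[k] A) u) :
    (Algebra.TensorProduct.assoc k k k A A A).toAlgHom.comp
      ((Algebra.TensorProduct.map Δ (.id k A)).comp Δ) =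
        (Algebra.TensorProduct.map (.id k A) Δ).comp Δ := by
  refine hu.comp_comp_eq_comp hΔ (l' := includeLeft) (r' := includeRight) (l'' := includeLeft)
    (r'' := includeRight) ?_ ?_ ?_ ?_ ?_ ?_ ?_
  all_goals exact AlgHom.ext fun x ↦ by simp [Algebra.TensorProduct.one_def]

theorem counit_left (hu : IsUniversal u) {Δ : A →ₐ[k] A ⊗[k] A}
    (hΔ : map Δ u = map (includeLeft : A →ₐ[k] A ⊗[k] A) u *
      map (includeRight : A →ₐ[k] A ⊗[k] A) u) {ε : A →ₐ[k] k} (hε : map ε u = 1) :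
    (Algebra.TensorProduct.map ε (.id k A)).comp Δ = (Algebra.TensorProduct.lid k A).symm := by
  apply hu.hom_ext
  rw [map_map hΔ, map_comp ε, hε, map_one, one_mul]
  rfl

theorem counit_right (hu : IsUniversal u) {Δ : A →ₐ[k] A ⊗[k] A}
    (hΔ : map Δ u = map (includeLeft : A →ₐ[k] A ⊗[k] A) u *
      map (includeRight : A →ₐ[k] A ⊗[k] A) u) {ε : A →ₐ[k] k} (hε : map ε u = 1) :
    (Algebra.TensorProduct.map (.id k A) ε).comp Δ = (Algebra.TensorProduct.rid k k A).symm := by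
  apply hu.hom_ext
  rw [map_map hΔ, map_comp ε, hε, map_one, mul_one]
  rfl

end IsUniversal

open Algebra.TensorProduct in
theorem exists_hopfAlgebra [FiniteDimensional k L] (ρ : (L ≃ₐ[k] L) →* MulAut M) :
    ∃ (A : Type u) (_ : CommRing A) (_ : HopfAlgebra k A) (u : torusPoints ρ A), IsUniversal u ∧
      map (Bialgebra.counitAlgHom k A) u = 1 ∧
      map (Bialgebra.comulAlgHom k A) u = map (includeLeft : A →ₐ[k] A ⊗[k] A) u *
        map (includeRight : A →ₐ[k] A ⊗[k] A) u := by
  obtain ⟨A, _, _, u, hu⟩ := exists_isUniversal ρ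
  obtain ⟨Δ, hΔ, -⟩ := hu _ (map (includeLeft : A →ₐ[k] A ⊗[k] A) u *
        map (includeRight : A →ₐ[k] A ⊗[k] A) u)
  obtain ⟨ε, hε, -⟩ := hu k 1
  obtain ⟨S, hS, -⟩ := hu A (inv u)
  have hε' : map ((Algebra.ofId k A).comp ε) u = 1 := by rw [map_comp, hε, map_one]
  have h1 : (Algebra.TensorProduct.lift S (.id k A) fun _ ↦ Commute.all _).comp Δ =
      (Algebra.ofId k A).comp ε := hu.hom_ext (by
    refine (IsUniversal.map_lift hΔ S (.id k A) _).trans ?_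
    rw [hS, map_id, inv_mul, hε'])
  have h2 : (Algebra.TensorProduct.lift (.id k A) S fun _ _ ↦ Commute.all _ _).comp Δ =
      (Algebra.ofId k A).comp ε := hu.hom_ext (by
    refine (IsUniversal.map_lift hΔ (.id k A) S _).trans ?_
    rw [hS, map_id, mul_comm, inv_mul, hε'])
  let B : Bialgebra k A := Bialgebra.ofAlgHom Δ ε
    (hu.coassoc hΔ) (hu.counit_left hΔ hε) (hu.counit_right hΔ hε)
  exact ⟨A, inferInstance, HopfAlgebra.ofAlgHom S h1 h2, u, hu, hε, hΔ⟩

end torusPoints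

/-! ### Splitting over extensions of L -/

section Splitting

universe u

variable {k L : Type u} [Field k] [Field L] [Algebra k L]
variable {R S : Type u} [CommRing R] [CommRing S] [Algebra k R] [Algebra k S]

/-- The multiplication map `R ⊗ L → R`, for an `L`-algebra `R`. -/
noncomputable def mulMap (j : L →ₐ[k] R) : R ⊗[k] L →ₐ[k] R :=
  Algebra.TensorProduct.lift (AlgHom.id k R) j fun _ _ ↦ Commute.all _ _

@[simp]
theorem mulMap_tmul (j : L →ₐ[k] R) (r : R) (l : L) : mulMap j (r ⊗ₜ l) = r * j l := rfl

theorem apply_mulMap (j : L →ₐ[k] R) (f : R →ₐ[k] S) (z : R ⊗[k] L) :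
    f (mulMap j z) = mulMap (f.comp j) (mapLeft L f z) := by
  induction z with
  | zero => simp
  | add x y hx hy => simp only [map_add, hx, hy]
  | tmul r l => simp

/-- Dedekind's independence of automorphisms: a relation between the rows is a relation between the
automorphisms on a basis. -/
theorem isUnit_matrix_galois_apply_basis [FiniteDimensional k L]
    [DecidableEq (L ≃ₐ[k] L)] (b : Module.Basis (L ≃ₐ[k] L) k L) :
    IsUnit (Matrix.of fun g i : L ≃ₐ[k] L ↦ g (b i)) := by
  rw [← Matrix.linearIndependent_rows_iff_isUnit, Fintype.linearIndependent_iff]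
  intro a ha
  have h1 : LinearIndependent L fun g : L ≃ₐ[k] L ↦ (g : L →ₐ[k] L).toLinearMap :=
    (linearIndependent_algHom_toLinearMap k L L).comp _ AlgEquiv.coe_toAlgHom_injective
  refine Fintype.linearIndependent_iff.1 h1 a (b.ext fun i ↦ ?_)
  have := congrFun ha i
  simpa [Finset.sum_apply, LinearMap.sum_apply] using this

/-- This is R ⊗ L ≅ ∏_g R. In coordinates the map is the invertible matrix (g(b_i)), pushed to R
along j. -/
theorem bijective_mulMap_galRight [FiniteDimensional k L] [IsGalois k L] (j : L →ₐ[k] R) :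
    Function.Bijective fun (z : R ⊗[k] L) (g : L ≃ₐ[k] L) ↦ mulMap j (galRight R g z) := by
  classical
  -- All that matters is that the basis is indexed by the Galois group, which makes the matrix
  -- square.
  let b := IsGalois.normalBasis k L
  have hu := (isUnit_matrix_galois_apply_basis b).map (j : L →+* R).mapMatrix
  generalize hB : (j : L →+* R).mapMatrix (Matrix.of fun g i : L ≃ₐ[k] L ↦ g (b i)) = B at hu
  have h1 : (fun (z : R ⊗[k] L) (g : L ≃ₐ[k] L) ↦ mulMap j (galRight R g z)) =
      B.mulVec ∘ (b.baseChange R).equivFun := by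
    funext z g
    obtain ⟨v, rfl⟩ := (b.baseChange R).equivFun.symm.surjective z
    simp only [Function.comp_apply, Module.Basis.equivFun_symm_apply,
      map_sum, Matrix.mulVec, dotProduct]
    refine Finset.sum_congr rfl fun i _ ↦ ?_
    simp [← hB, TensorProduct.smul_tmul', mul_comm]
  rw [h1]
  refine Function.Bijective.comp ?_ (b.baseChange R).equivFun.bijective
  obtain ⟨⟨B, C, hBC, hCB⟩, rfl⟩ := hu
  exact Function.bijective_iff_has_inverse.2 ⟨C.mulVec, fun v ↦ by simp [hCB], fun v ↦ by simp [hBC]⟩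

variable {M : Type} [CommGroup M] {ρ : (L ≃ₐ[k] L) →* MulAut M}

namespace torusPoints

/-- Over an extension of the splitting field, points with prescribed values exist. -/
theorem exists_mulMap_eq [FiniteDimensional k L] [IsGalois k L] (j : L →ₐ[k] R) (w : M →* R) :
    ∃ m : torusPoints ρ R, ∀ x, mulMap j (m.1 x) = w x := by
  obtain ⟨hinj, hsurj⟩ := bijective_mulMap_galRight (R := R) j
  -- Equivariance forces the g-component of m x to be w (ρ g x).
  choose m hm using fun x ↦ hsurj fun g ↦ w (ρ g x)
  have hm' : ∀ x g, mulMap j (galRight R g (m x)) = w (ρ g x) := fun x g ↦ congrFun (hm x) g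
  refine ⟨⟨{ toFun := m, map_one' := hinj ?_, map_mul' := fun x y ↦ hinj ?_ }, fun g x ↦ hinj ?_⟩,
    fun x ↦ ?_⟩
  · funext g; simp [hm']
  · funext g; simp [hm']
  · funext h
    change mulMap j (galRight R h (m (ρ g x))) = mulMap j (galRight R h (galRight R g (m x)))
    rw [hm', ← galRight_mul, hm', map_mul, MulAut.mul_apply]
  · have := hm' x 1
    rwa [galRight_one, map_one, MulAut.one_apply] at this

theorem ext_of_mulMap [FiniteDimensional k L] [IsGalois k L] (j : L →ₐ[k] R)
    {m n : torusPoints ρ R} (h : ∀ x, mulMap j (m.1 x) = mulMap j (n.1 x)) : m = n := by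
  ext x
  refine (bijective_mulMap_galRight j).1 (funext fun g ↦ ?_)
  change mulMap j (galRight R g (m.1 x)) = mulMap j (galRight R g (n.1 x))
  rw [← m.2, ← n.2, h]

variable {A : Type u} [CommRing A] [HopfAlgebra k A] {u : torusPoints ρ A}

-- Over an algebra containing L, an equivariant point is the same as a homomorphism from M to that
-- algebra. The universal point yields ψ : K[M] → K ⊗ A, and the tautological M → K[M] yields its
-- inverse θ. The images w x are group-like by `hε` and `hΔ`, so ψ respects the bialgebra
-- structures.
open Algebra.TensorProduct in
theorem IsUniversal.nonempty_bialgEquiv [FiniteDimensional k L] [IsGalois k L]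
    (hu : IsUniversal u) (hε : map (Bialgebra.counitAlgHom k A) u = 1)
    (hΔ : map (Bialgebra.comulAlgHom k A) u = map (includeLeft : A →ₐ[k] A ⊗[k] A) u *
        map (includeRight : A →ₐ[k] A ⊗[k] A) u)
    {K : Type u} [Field K] [Algebra k K] (j : L →ₐ[k] K) :
    Nonempty ((K ⊗[k] A) ≃ₐc[K] MonoidAlgebra K M) := by
  let i : A →ₐ[k] K ⊗[k] A := includeRight
  let jH : L →ₐ[k] K ⊗[k] A := (includeLeft : K →ₐ[k] K ⊗[k] A).comp j
  let jM : L →ₐ[k] MonoidAlgebra K M := (IsScalarTower.toAlgHom k K (MonoidAlgebra K M)).comp j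
  let w : M →* K ⊗[k] A := (mulMap jH : _ →* _).comp (map i u).1
  have hw : ∀ x, w x = mulMap jH (mapLeft L i (u.1 x)) := fun x ↦ rfl
  let ψ : MonoidAlgebra K M →ₐ[K] K ⊗[k] A := MonoidAlgebra.lift K _ M w
  have hψ : ∀ x, ψ (MonoidAlgebra.single x 1) = w x := fun x ↦ by simp [ψ]
  obtain ⟨m₀, hm₀⟩ := exists_mulMap_eq (ρ := ρ) jM (MonoidAlgebra.of K M)
  obtain ⟨θ₀, hθ₀, -⟩ := hu _ m₀
  let θ : K ⊗[k] A →ₐ[K] MonoidAlgebra K M :=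
    Algebra.TensorProduct.lift (Algebra.ofId K _) θ₀ fun _ _ ↦ Commute.all _ _
  have hθi : (θ.restrictScalars k).comp i = θ₀ := AlgHom.ext fun a ↦ by simp [θ, i]
  have hθj : (θ.restrictScalars k).comp jH = jM := AlgHom.ext fun a ↦ by
    simp [θ, jH, jM, Algebra.ofId_apply]
  have hψj : (ψ.restrictScalars k).comp jM = jH := AlgHom.ext fun a ↦ by
    exact ψ.commutes (j a)
  have h1 : θ.comp ψ = AlgHom.id K _ := by
    refine MonoidAlgebra.algHom_ext (fun x ↦ ?_) (by ext)
    rw [AlgHom.comp_apply, hψ, hw]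
    change (θ.restrictScalars k) (mulMap jH (mapLeft L i (u.1 x))) = _
    rw [apply_mulMap, hθj, ← mapLeft_comp_apply, hθi, ← map_val_apply, hθ₀, hm₀]
    rfl
  have h2 : ((ψ.restrictScalars k).comp (θ.restrictScalars k)).comp i = i := hu.hom_ext (by
    refine ext_of_mulMap jH fun x ↦ ?_
    rw [AlgHom.comp_assoc, hθi, map_comp, hθ₀, map_val_apply, ← hψj, ← apply_mulMap, hm₀, hψj]
    exact hψ x)
  have h3 : ψ.comp θ = AlgHom.id K _ := by
    apply Algebra.TensorProduct.ext'
    intro c a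
    have := DFunLike.congr_fun h2 a
    have h4 : ψ (θ ((1 : K) ⊗ₜ a)) = (1 : K) ⊗ₜ a := this
    have h5 : c ⊗ₜ[k] a = c • ((1 : K) ⊗ₜ[k] a) := by simp [TensorProduct.smul_tmul']
    rw [AlgHom.comp_apply, h5, map_smul, map_smul, h4]
    rfl
  let e : MonoidAlgebra K M ≃ₐ[K] K ⊗[k] A := AlgEquiv.ofAlgHom ψ θ h3 h1
  have hcounit : ∀ x, Coalgebra.counit (R := K) (w x) = 1 := fun x ↦ by
    let ε : K ⊗[k] A →ₐ[k] K := (Bialgebra.counitAlgHom K (K ⊗[k] A)).restrictScalars k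
    have h4 : ε.comp i = (Algebra.ofId k K).comp (Bialgebra.counitAlgHom k A) :=
      Bialgebra.counitAlgHom_comp_includeRight
    change ε (w x) = 1
    rw [hw, apply_mulMap, ← mapLeft_comp_apply, h4, ← map_val_apply, map_comp, hε, _root_.map_one]
    exact _root_.map_one _
  have hcomul : ∀ x, Coalgebra.comul (R := K) (w x) = w x ⊗ₜ w x := fun x ↦ by
    let Δ : K ⊗[k] A →ₐ[k] (K ⊗[k] A) ⊗[K] (K ⊗[k] A) :=
      (Bialgebra.comulAlgHom K (K ⊗[k] A)).restrictScalars k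
    let l : K ⊗[k] A →ₐ[k] (K ⊗[k] A) ⊗[K] (K ⊗[k] A) :=
      (includeLeft : K ⊗[k] A →ₐ[K] (K ⊗[k] A) ⊗[K] (K ⊗[k] A)).restrictScalars k
    let r : K ⊗[k] A →ₐ[k] (K ⊗[k] A) ⊗[K] (K ⊗[k] A) :=
      (includeRight : K ⊗[k] A →ₐ[K] (K ⊗[k] A) ⊗[K] (K ⊗[k] A)).restrictScalars k
    have hlj : ∀ (f : K ⊗[k] A →ₐ[K] (K ⊗[k] A) ⊗[K] (K ⊗[k] A)),
        (f.restrictScalars k).comp jH =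
          (IsScalarTower.toAlgHom k K ((K ⊗[k] A) ⊗[K] (K ⊗[k] A))).comp j := fun f ↦
      AlgHom.ext fun a ↦ f.commutes (j a)
    have h4 : Δ.comp i = (Algebra.TensorProduct.lift (l.comp i) (r.comp i)
        fun _ _ ↦ Commute.all _ _).comp (Bialgebra.comulAlgHom k A) := by
      refine AlgHom.ext fun a ↦ ?_
      let c := Coalgebra.Repr.arbitrary k a
      change Coalgebra.comul (R := K) ((1 : K) ⊗ₜ[k] a) =
        Algebra.TensorProduct.lift (l.comp i) (r.comp i)
          (fun _ _ ↦ Commute.all _ _) (Coalgebra.comul a)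
      rw [comul_tmul_eq_sum 1 c, ← c.eq, map_sum]
      refine Finset.sum_congr rfl fun n _ ↦ ?_
      simp [l, r, i]
    change Δ (w x) = _
    rw [hw, apply_mulMap, ← mapLeft_comp_apply, h4, ← map_val_apply, IsUniversal.map_lift hΔ]
    change mulMap (Δ.comp jH) ((map (l.comp i) u).1 x * (map (r.comp i) u).1 x) = _
    rw [map_mul, map_val_apply, map_val_apply, mapLeft_comp_apply, mapLeft_comp_apply]
    have h5 : Δ.comp jH = l.comp jH := by rw [hlj, hlj]
    have h6 : Δ.comp jH = r.comp jH := by rw [hlj, hlj]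
    nth_rw 1 [h5]
    rw [h6, ← apply_mulMap, ← apply_mulMap]
    simp [l, r]
  have he : ∀ x, e (MonoidAlgebra.single x 1) = w x := hψ
  have h4 : (Bialgebra.counitAlgHom K (K ⊗[k] A)).comp (e : MonoidAlgebra K M →ₐ[K] K ⊗[k] A) =
      Bialgebra.counitAlgHom K (MonoidAlgebra K M) :=
    MonoidAlgebra.algHom_ext (fun x ↦ by simp [he, hcounit]) (by ext)
  have h5 : (Algebra.TensorProduct.map (e : MonoidAlgebra K M →ₐ[K] K ⊗[k] A)
      (e : MonoidAlgebra K M →ₐ[K] K ⊗[k] A)).comp (Bialgebra.comulAlgHom K (MonoidAlgebra K M)) =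
      (Bialgebra.comulAlgHom K (K ⊗[k] A)).comp (e : MonoidAlgebra K M →ₐ[K] K ⊗[k] A) :=
    MonoidAlgebra.algHom_ext (fun x ↦ by simp [he, hcomul]) (by ext)
  exact ⟨(BialgEquiv.ofAlgEquiv e h4 h5).symm⟩

end torusPoints

end Splitting

/-! ### Rational points and a lattice attaining the bound -/

open scoped IntermediateField

universe u

namespace torusPoints

variable {k L : Type u} [Field k] [Field L] [Algebra k L]
variable {M : Type} [CommGroup M] {ρ : (L ≃ₐ[k] L) →* MulAut M}
variable {A : Type u} [CommRing A] [HopfAlgebra k A] {u : torusPoints ρ A}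

-- Universality makes f ↦ `map f u` a bijection onto the equivariant points over k, and `hΔ` makes
-- it multiplicative. The map asked for is its inverse.
open Algebra.TensorProduct in
theorem IsUniversal.exists_points_monoidHom (hu : IsUniversal u)
    (hΔ : map (Bialgebra.comulAlgHom k A) u = map (includeLeft : A →ₐ[k] A ⊗[k] A) u *
        map (includeRight : A →ₐ[k] A ⊗[k] A) u) :
    ∃ Φ : torusPoints ρ k →* WithConv (A →ₐ[k] k), Function.Injective Φ := by
  have hmul : ∀ x y : WithConv (A →ₐ[k] k),
      map (x * y).ofConv u = map x.ofConv u * map y.ofConv u := fun x y ↦ by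
    have h1 : (x * y).ofConv = (Algebra.TensorProduct.lift x.ofConv y.ofConv
        fun _ _ ↦ Commute.all _ _).comp (Bialgebra.comulAlgHom k A) :=
      AlgHom.ext fun a ↦ AlgHom.convMul_apply x y a
    rw [h1, IsUniversal.map_lift hΔ]
  let e : WithConv (A →ₐ[k] k) ≃* torusPoints ρ k :=
    MulEquiv.ofBijective (⟨fun x ↦ map x.ofConv u, hmul⟩ : WithConv (A →ₐ[k] k) →ₙ* _)
      ⟨fun x y h ↦ WithConv.ext (hu.hom_ext h), fun m ↦ by
        obtain ⟨f, hf, -⟩ := hu k m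
        exact ⟨WithConv.toConv f, hf⟩⟩
  exact ⟨e.symm.toMonoidHom, e.symm.injective⟩

theorem equivariant_of_generator {τ : L ≃ₐ[k] L} [Finite (L ≃ₐ[k] L)]
    (hτ : ∀ g, g ∈ Subgroup.zpowers τ)
    (m : M → k ⊗[k] L) (h : ∀ x, m (ρ τ x) = galRight k τ (m x)) (g : L ≃ₐ[k] L) (x : M) :
    m (ρ g x) = galRight k g (m x) := by
  obtain ⟨n, rfl⟩ := mem_powers_iff_mem_zpowers.2 (hτ g)
  simp only
  induction n generalizing x with
  | zero => simp [galRight_one]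
  | succ n ih => rw [pow_succ', map_mul, MulAut.mul_apply, h, ih, galRight_mul]

end torusPoints

/-- The action of the linear automorphisms of `V` on `V`, written multiplicatively. -/
def Module.End.unitsToMulAut (V : Type*) [AddCommGroup V] :
    (Module.End ℤ V)ˣ →* MulAut (Multiplicative V) where
  toFun s :=
    { toFun x := .ofAdd (s.1 x.toAdd)
      invFun x := .ofAdd (s⁻¹.1 x.toAdd)
      left_inv x := by
        change Multiplicative.ofAdd ((s⁻¹.1 * s.1) x.toAdd) = x
        rw [Units.inv_mul]; rfl
      right_inv x := by
        change Multiplicative.ofAdd ((s.1 * s⁻¹.1) x.toAdd) = x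
        rw [Units.mul_inv]; rfl
      map_mul' x y := by simp }
  map_one' := rfl
  map_mul' s s' := rfl

open Polynomial in
/-- There is a lattice with an automorphism of order dividing `t` that admits `r` independent
functionals to `ℤ/p` with eigenvalue of order `t`, as soon as its rank is at least `r * φ(t)`. -/
theorem exists_end_with_eigenFunctionals {p t r d : ℕ} [Fact p.Prime] (ht : 0 < t)
    {c : ZMod p} (hc : IsPrimitiveRoot c t) (hd : r * t.totient ≤ d) :
    ∃ (s : Module.End ℤ (Fin d → ℤ)) (F : (Fin r → ZMod p) →+ ((Fin d → ℤ) →ₗ[ℤ] ZMod p)),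
      s ^ t = 1 ∧ Function.Injective F ∧ ∀ w, F w ∈ eigenFunctionals s c := by
  classical
  let O := AdjoinRoot (cyclotomic t ℤ)
  let b := AdjoinRoot.powerBasis' (cyclotomic.monic t ℤ)
  have : Module.Free ℤ O := Module.Free.of_basis b.basis
  have : Module.Finite ℤ O := Module.Finite.of_basis b.basis
  have hO : Module.finrank ℤ O = t.totient := by
    rw [b.finrank, AdjoinRoot.powerBasis'_dim, natDegree_cyclotomic]
  -- The second factor, with trivial action, pads the rank from r φ(t) to d.
  let X := (Fin r → O) × (Fin (d - r * t.totient) → ℤ)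
  have hX : Module.finrank ℤ X = d := by
    rw [Module.finrank_prod, Module.finrank_pi_fintype]
    simp [hO, hd]
  let E : X ≃ₗ[ℤ] (Fin d → ℤ) := LinearEquiv.ofFinrankEq _ _ (by simp [hX])
  let ω : O := AdjoinRoot.root (cyclotomic t ℤ)
  have hω : ω ^ t = 1 := by
    have h1 := (cyclotomic.dvd_X_pow_sub_one t ℤ)
    rw [← AdjoinRoot.mk_eq_zero] at h1
    simpa [sub_eq_zero] using h1
  let ev : O →+* ZMod p := AdjoinRoot.lift (Int.castRingHom (ZMod p)) c (by
    rw [← eval_map, map_cyclotomic_int]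
    exact hc.isRoot_cyclotomic ht)
  have hev : ev ω = c := AdjoinRoot.lift_root _
  let s₀ : Module.End ℤ X :=
    LinearMap.prodMap (LinearMap.pi fun i ↦ LinearMap.mulLeft ℤ ω ∘ₗ LinearMap.proj i)
      LinearMap.id
  have hs₁ : ∀ x, s₀ x = (fun i ↦ ω * x.1 i, x.2) := fun x ↦ rfl
  have hs₀ : ∀ n x, (s₀ ^ n) x = (fun i ↦ ω ^ n * x.1 i, x.2) := fun n x ↦ by
    induction n with
    | zero => simp
    | succ n ih =>
      rw [pow_succ', Module.End.mul_apply, ih, hs₁]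
      simp only [pow_succ', mul_assoc]
  let F : (Fin r → ZMod p) →+ ((Fin d → ℤ) →ₗ[ℤ] ZMod p) :=
    AddMonoidHom.mk' (fun w ↦ ∑ i, w i • (ev.toAddMonoidHom.toIntLinearMap ∘ₗ
      LinearMap.proj i ∘ₗ LinearMap.fst ℤ (Fin r → O) (Fin (d - r * t.totient) → ℤ) ∘ₗ
        E.symm.toLinearMap)) fun w w' ↦ by simp [add_smul, Finset.sum_add_distrib]
  have hF : ∀ w v, F w v = ∑ i, w i * ev ((E.symm v).1 i) := fun w v ↦ by
    simp [F, LinearMap.sum_apply]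
  refine ⟨E.conjRingEquiv s₀, F, ?_, fun w w' h ↦ ?_, fun w v ↦ ?_⟩
  · rw [← map_pow, ← map_one E.conjRingEquiv]
    congr 1
    refine LinearMap.ext fun x ↦ ?_
    rw [hs₀, hω]
    simp
  · funext i
    -- On the i-th unit vector the functional of w takes the value w i.
    have := DFunLike.congr_fun h (E (Pi.single i 1, 0))
    simpa [hF, Pi.single_apply, apply_ite ev] using this
  · have h1 : E.symm (E.conjRingEquiv s₀ v) = s₀ (E.symm v) := by simp
    rw [hF, hF, h1, hs₁, Finset.mul_sum]
    refine Finset.sum_congr rfl fun i _ ↦ ?_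
    rw [map_mul, hev, mul_left_comm]

/-! ### Sharpness and conclusion -/

namespace AlgebraicTorus

variable {k : Type u} [Field k] {d : ℕ}

theorem exists_injective_pTorsion {p r : ℕ} [Fact p.Prime]
    (hpk : (p : k) ≠ 0) {ζ : AlgebraicClosure k} (hζ : IsPrimitiveRoot ζ p)
    (hd : r * (Module.finrank k k⟮ζ⟯).totient ≤ d) :
    ∃ (T : AlgebraicTorus k d) (Φ : Multiplicative (Fin r → ZMod p) →* T.pTorsion p),
      Function.Injective Φ := by
  have hp : p.Prime := Fact.out
  have : NeZero p := ⟨hp.ne_zero⟩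
  obtain ⟨_, _, τ, c, hτ, hc, hτc⟩ := hζ.exists_galois_generator hpk
  obtain ⟨s, F, hs, hF, hFs⟩ := exists_end_with_eigenFunctionals Module.finrank_pos hc hd
  set z := IntermediateField.AdjoinSimple.gen k ζ with hz
  have hzp : IsPrimitiveRoot z p := by
    refine IsPrimitiveRoot.of_map_of_injective (f := algebraMap k⟮ζ⟯ (AlgebraicClosure k)) ?_
      (algebraMap k⟮ζ⟯ (AlgebraicClosure k)).injective
    simpa [hz] using hζ
  let S : (Module.End ℤ (Fin d → ℤ))ˣ := Units.ofPowEqOne s _ hs Module.finrank_pos.ne'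
  -- Since s^t = 1 and τ has order t, sending τ to s defines an action of the whole Galois group.
  have hord : orderOf (Module.End.unitsToMulAut _ S) ∣ orderOf τ := by
    rw [orderOf_eq_card_of_forall_mem_zpowers hτ, IsGalois.card_aut_eq_finrank]
    apply orderOf_dvd_of_pow_eq_one
    rw [← map_pow, Units.pow_ofPowEqOne, map_one]
  let ρ : (k⟮ζ⟯ ≃ₐ[k] k⟮ζ⟯) →* MulAut (Multiplicative (Fin d → ℤ)) :=
    monoidHomOfForallMemZpowers hτ hord
  have hρ : ∀ x, ρ τ x = Multiplicative.ofAdd (s x.toAdd) := fun x ↦ by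
    have : ρ τ = Module.End.unitsToMulAut _ S := monoidHomOfForallMemZpowers_apply_gen hτ hord
    rw [this]; rfl
  obtain ⟨A, _, _, u, hu, hε, hΔ⟩ := torusPoints.exists_hopfAlgebra ρ
  obtain ⟨e⟩ := hu.nonempty_bialgEquiv hε hΔ (IntermediateField.val k⟮ζ⟯)
  let T : AlgebraicTorus k d :=
    { coordRing := A
      split := ⟨e.trans (AddMonoidAlgebra.toMultiplicativeBialgEquiv _ _ _).symm⟩ }
  obtain ⟨Ψ, hΨ⟩ := hu.exists_points_monoidHom hΔ
  -- Exponentiating an eigenfunctional to base z gives an equivariant point, because τ z = z^c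
  -- matches the eigenvalue c.
  let m : (Fin r → ZMod p) → torusPoints ρ k := fun w ↦
    ⟨{ toFun x := 1 ⊗ₜ (z ^ (F w x.toAdd).val)
       map_one' := by simp [Algebra.TensorProduct.one_def]
       map_mul' x y := by simp [hzp.pow_val_add] },
      torusPoints.equivariant_of_generator hτ _ fun x ↦ by
        simp [hρ, hFs w x.toAdd, hzp.pow_val_mul, hτc]⟩
  have hm : ∀ w w', m (w + w') = m w * m w' := fun w w' ↦ by
    ext x
    change (1 : k) ⊗ₜ[k] (z ^ (F (w + w') x.toAdd).val) =
      (1 : k) ⊗ₜ[k] (z ^ (F w x.toAdd).val) * (1 : k) ⊗ₜ[k] (z ^ (F w' x.toAdd).val)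
    simp [hzp.pow_val_add]
  have hminj : Function.Injective m := fun w w' h ↦ by
    refine hF (LinearMap.ext fun v ↦ hzp.pow_val_injective ?_)
    have h1 : (1 : k) ⊗ₜ[k] (z ^ (F w v).val) = (1 : k) ⊗ₜ[k] (z ^ (F w' v).val) :=
      DFunLike.congr_fun (congrArg Subtype.val h) (Multiplicative.ofAdd v)
    simpa using congrArg (TensorProduct.lid k k⟮ζ⟯) h1
  let Φ₀ : Multiplicative (Fin r → ZMod p) →* T.Points :=
    MonoidHom.mk' (fun w ↦ Ψ (m w.toAdd)) fun w w' ↦ by rw [toAdd_mul, hm, map_mul]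
  refine ⟨T, Φ₀.codRestrict (T.pTorsion p) fun w ↦ ?_, fun w w' h ↦ ?_⟩
  · change Φ₀ w ^ p = 1
    rw [← map_pow]
    have : w ^ p = 1 := by
      apply Multiplicative.toAdd.injective
      rw [toAdd_pow, toAdd_one]
      funext i
      simp
    rw [this, map_one]
  · exact Multiplicative.toAdd.injective (hminj (hΨ (congrArg Subtype.val h)))

end AlgebraicTorus

theorem theorem2p2 {k : Type*} [Field k] [PerfectField k]
    (p : ℕ) (hp : p.Prime) (hpk : ringChar k ≠ p)
    (ζ : AlgebraicClosure k) (hζ : IsPrimitiveRoot ζ p)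
    (t : ℕ) (ht : t = Module.finrank k (IntermediateField.adjoin k {ζ})) :
    (∀ (d : ℕ) (T : AlgebraicTorus k d),
      ∃ r : ℕ, IsElementaryOfRank p (T.pTorsion p) r ∧ (r : ℚ) ≤ (d : ℚ) / (Nat.totient t : ℚ)) ∧
    (∀ d : ℕ, ∃ T : AlgebraicTorus k d,
      IsElementaryOfRank p (T.pTorsion p) ⌊(d : ℚ) / (Nat.totient t : ℚ)⌋₊) := by
  have : Fact p.Prime := ⟨hp⟩
  have hpk' : (p : k) ≠ 0 := fun h ↦ by
    rcases (Nat.dvd_prime hp).1 (ringChar.dvd h) with h1 | h1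
    · exact CharP.ringChar_ne_one h1
    · exact hpk h1
  have htot : 0 < t.totient := by
    obtain ⟨_, -⟩ := hζ.exists_galois_generator hpk'
    exact Nat.totient_pos.2 (ht ▸ Module.finrank_pos)
  subst ht
  refine ⟨fun d T ↦ ?_, fun d ↦ ?_⟩
  · obtain ⟨r, hr, hrd⟩ := T.exists_isElementaryOfRank_pTorsion_le hpk' hζ
    refine ⟨r, hr, ?_⟩
    rw [le_div_iff₀ (by exact_mod_cast htot)]
    exact_mod_cast hrd
  · rw [Nat.floor_div_eq_div]
    -- The embedded (ℤ/p)^⌊d/φ(t)⌋ bounds the rank from below by comparing cardinalities, and the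
    -- upper bound already proved gives equality.
    obtain ⟨T, Φ, hΦ⟩ := AlgebraicTorus.exists_injective_pTorsion (d := d) hpk' hζ
      (Nat.div_mul_le_self d _)
    obtain ⟨r, hr, hrd⟩ := T.exists_isElementaryOfRank_pTorsion_le hpk' hζ
    have hcard := hr.card
    have : Finite (T.pTorsion p) := Nat.finite_of_card_ne_zero (by
      rw [hcard]; exact pow_ne_zero _ hp.ne_zero)
    have h1 := Nat.card_le_card_of_injective Φ hΦ
    rw [hcard, IsElementaryOfRank.card ⟨MulEquiv.refl _⟩] at h1
    have h2 := (Nat.pow_le_pow_iff_right hp.one_lt).1 h1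
    have h3 := (Nat.le_div_iff_mul_le htot).2 hrd
    refine ⟨T, ?_⟩
    rwa [le_antisymm h2 h3]
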